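/- Fix the scalar field $\mathbb{R}$ or $\mathbb{C}$. A Banach space $X$ is finitely representable in $Y$ if for every $\varepsilon>0$ and every finite-dimensional subspace $A\subseteq X$ there are a subspace $B\subseteq Y$ and an isomorphism $u:A\to B$ with $\|u\|\,\|u^{-1}\|\le 1+\varepsilon$. The class $X^{f}$ consists of all Banach spaces $Y$ such that $X$ and $Y$ are finitely representable in each other. Let $\mathfrak{M}$ (the Minkowski space) be the set of all finite-dimensional Banach spaces, isometric spaces being identified, with the topology of the metric $\log d$, where $d(A,B)=\inf\{\|u\|\,\|u^{-1}\| : u:A\to B \text{ an isomorphism}\}$ is the Banach--Mazur distance (spaces of different dimensions are at distance $\infty$; the distance of a zero-dimensional space from itself is $0$). For a Banach space $X$ let $H(X)\subseteq\mathfrak{M}$ be the set of (isometry classes of) its finite-dimensional subspaces. The Minkowski base $\mathfrak{M}(X^{f})$ is the closure $\overline{H(Y)}$ in $\mathfrak{M}$, which is the same set for all $Y\in X^{f}$. **Theorem.** Let $\mathfrak{N}\subseteq\mathfrak{M}$ be a nonempty set of finite-dimensional Banach spaces such that (C) $\mathfrak{N}$ is closed in $\mathfrak{M}$; (H) if $A\in\mathfrak{N}$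 and $B\in H(A)$, then $B\in\mathfrak{N}$; (A$_0$) for any $A,B\in\mathfrak{N}$ there is $C\in\mathfrak{N}$ with $A\in H(C)$ and $B\in H(C)$. Then there exists a Banach space $X$ such that $\mathfrak{N}=\mathfrak{M}(X^{f})$. Moreover, $X$ can be chosen to be an ultraproduct, with respect to some ultrafilter $D$ on the set $\mathfrak{N}$, of the family of all spaces $A\in\mathfrak{N}$, i.e. the quotient of the space of bounded families $(x_A)_{A\in\mathfrak{N}}$, $x_A\in A$, with the supremum norm, by the subspace of families with $\lim_{D}\|x_A\|=0$. -/

import Mathlib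

open scoped ENNReal Topology
open Filter

universe u v w

noncomputable section

/-! ### Finite-dimensional normed spaces up to isometry -/

/-- A norm on `𝕜ⁿ`, for some `n` (the value `n = 0` is allowed). -/
structure FinNorm (𝕜 : Type u) [RCLike 𝕜] where
  /-- the dimension -/
  dim : ℕ
  /-- the norm -/
  toSeminorm : Seminorm 𝕜 (Fin dim → 𝕜)
  eq_zero_of_norm_eq_zero : ∀ x, toSeminorm x = 0 → x = 0

namespace FinNorm

variable {𝕜 : Type u} [RCLike 𝕜]

/-- The vector space `𝕜ⁿ`, to be equipped with the norm `p`. -/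
def Space (p : FinNorm 𝕜) : Type u := Fin p.dim → 𝕜

instance (p : FinNorm 𝕜) : NormedAddCommGroup p.Space :=
  AddGroupNorm.toNormedAddCommGroup (E := Fin p.dim → 𝕜)
    { toFun := fun x => p.toSeminorm x
      map_zero' := map_zero p.toSeminorm
      add_le' := map_add_le_add p.toSeminorm
      neg' := map_neg_eq_map p.toSeminorm
      eq_zero_of_map_eq_zero' := p.eq_zero_of_norm_eq_zero }

instance (p : FinNorm 𝕜) : NormedSpace 𝕜 p.Space where
  toModule := inferInstanceAs (Module 𝕜 (Fin p.dim → 𝕜))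
  norm_smul_le a x := le_of_eq (map_smul_eq_mul p.toSeminorm a x)

instance (p : FinNorm 𝕜) : FiniteDimensional 𝕜 p.Space :=
  inferInstanceAs (FiniteDimensional 𝕜 (Fin p.dim → 𝕜))

instance (p : FinNorm 𝕜) : CompleteSpace p.Space := FiniteDimensional.complete 𝕜 p.Space

/-- Two norms are identified when the spaces that they define are linearly isometric. -/
instance isometrySetoid (𝕜 : Type u) [RCLike 𝕜] : Setoid (FinNorm 𝕜) where
  r p q := Nonempty (p.Space ≃ₗᵢ[𝕜] q.Space)
  iseqv :=
    { refl := fun _ => ⟨LinearIsometryEquiv.refl 𝕜 _⟩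
      symm := fun ⟨e⟩ => ⟨e.symm⟩
      trans := fun ⟨e⟩ ⟨f⟩ => ⟨e.trans f⟩ }

end FinNorm

/-- The Minkowski space: all finite-dimensional Banach spaces over `𝕜`, up to isometry. -/
def Minkowski (𝕜 : Type u) [RCLike 𝕜] : Type u := Quotient (FinNorm.isometrySetoid 𝕜)

namespace Minkowski

variable {𝕜 : Type u} [RCLike 𝕜]

/-- A finite-dimensional Banach space in the isometry class `A`. -/
abbrev Space (A : Minkowski 𝕜) : Type u := (Quotient.out A).Space

end Minkowski

/-! ### Banach–Mazur distance and the topology of the Minkowski space -/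

/-- The Banach–Mazur distance: the infimum of `‖u‖ ‖u⁻¹‖` over all isomorphisms `u`,
equal to `∞` if there are none. -/
def banachMazur (𝕜 : Type u) [RCLike 𝕜] (X : Type v) (Y : Type w)
    [NormedAddCommGroup X] [NormedSpace 𝕜 X] [NormedAddCommGroup Y] [NormedSpace 𝕜 Y] : ℝ≥0∞ :=
  ⨅ u : X ≃L[𝕜] Y, ‖(u : X →L[𝕜] Y)‖ₑ * ‖(u.symm : Y →L[𝕜] X)‖ₑ

section banachMazur

variable (𝕜 : Type u) [RCLike 𝕜]

theorem banachMazur_self_le (X : Type v) [NormedAddCommGroup X] [NormedSpace 𝕜 X] :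
    banachMazur 𝕜 X X ≤ 1 := by
  refine (iInf_le _ (ContinuousLinearEquiv.refl 𝕜 X)).trans ?_
  have h : ‖ContinuousLinearMap.id 𝕜 X‖ₑ ≤ 1 := by
    rw [← ofReal_norm, ← ENNReal.ofReal_one]
    exact ENNReal.ofReal_le_ofReal ContinuousLinearMap.norm_id_le
  calc _ ≤ (1 : ℝ≥0∞) * 1 := mul_le_mul' h h
    _ = 1 := one_mul 1

theorem banachMazur_comm (X : Type v) (Y : Type w)
    [NormedAddCommGroup X] [NormedSpace 𝕜 X] [NormedAddCommGroup Y] [NormedSpace 𝕜 Y] :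
    banachMazur 𝕜 X Y = banachMazur 𝕜 Y X := by
  apply le_antisymm
  · exact le_iInf fun u => (iInf_le _ u.symm).trans (by rw [mul_comm]; simp)
  · exact le_iInf fun u => (iInf_le _ u.symm).trans (by rw [mul_comm]; simp)

/-- The logarithm of the Banach–Mazur distance, with values in `[0, ∞]`; the truncation at `0`
only concerns zero spaces, where `‖u‖ ‖u⁻¹‖ = 0`. -/
def logBanachMazur (X : Type v) (Y : Type w)
    [NormedAddCommGroup X] [NormedSpace 𝕜 X] [NormedAddCommGroup Y] [NormedSpace 𝕜 Y] : ℝ≥0∞ :=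
  (ENNReal.log (banachMazur 𝕜 X Y)).toENNReal

theorem logBanachMazur_triangle (X Y Z : Type v)
    [NormedAddCommGroup X] [NormedSpace 𝕜 X] [NormedAddCommGroup Y] [NormedSpace 𝕜 Y]
    [NormedAddCommGroup Z] [NormedSpace 𝕜 Z] :
    logBanachMazur 𝕜 X Z ≤ logBanachMazur 𝕜 X Y + logBanachMazur 𝕜 Y Z := by
  have h : banachMazur 𝕜 X Z ≤ banachMazur 𝕜 X Y * banachMazur 𝕜 Y Z ∨
      logBanachMazur 𝕜 X Y = ⊤ ∨ logBanachMazur 𝕜 Y Z = ⊤ := by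
    by_cases h1 : IsEmpty (X ≃L[𝕜] Y)
    · right; left; simp [logBanachMazur, banachMazur]
    by_cases h2 : IsEmpty (Y ≃L[𝕜] Z)
    · right; right; simp [logBanachMazur, banachMazur]
    rw [not_isEmpty_iff] at h1 h2
    left
    refine ENNReal.le_iInf_mul_iInf ⟨h1.some, ENNReal.mul_ne_top enorm_ne_top enorm_ne_top⟩
      ⟨h2.some, ENNReal.mul_ne_top enorm_ne_top enorm_ne_top⟩ fun u v => ?_
    refine (iInf_le _ (u.trans v)).trans ?_
    have hu : ‖((u.trans v : X ≃L[𝕜] Z) : X →L[𝕜] Z)‖ₑ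
        ≤ ‖(v : Y →L[𝕜] Z)‖ₑ * ‖(u : X →L[𝕜] Y)‖ₑ :=
      ContinuousLinearMap.opENorm_comp_le (v : Y →L[𝕜] Z) (u : X →L[𝕜] Y)
    have hv : ‖((u.trans v).symm : Z →L[𝕜] X)‖ₑ
        ≤ ‖(u.symm : Y →L[𝕜] X)‖ₑ * ‖(v.symm : Z →L[𝕜] Y)‖ₑ :=
      ContinuousLinearMap.opENorm_comp_le (u.symm : Y →L[𝕜] X) (v.symm : Z →L[𝕜] Y)
    exact (mul_le_mul' hu hv).trans (le_of_eq (by ring))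
  rcases h with h | h | h
  · refine (EReal.toENNReal_le_toENNReal (ENNReal.log_monotone h)).trans ?_
    rw [ENNReal.log_mul_add]
    exact EReal.toENNReal_add_le
  · rw [h, top_add]; exact le_top
  · rw [h, add_top]; exact le_top

end banachMazur

/-- The Minkowski space carries the metric `log d`, with distance `∞` between spaces of different
dimensions: its topology is that of the disjoint union of the Minkowski compacts. (Points at
distance `0` are equal; only the topology is used, so this is not recorded here.) -/
instance (𝕜 : Type u) [RCLike 𝕜] : PseudoEMetricSpace (Minkowski 𝕜) where
  edist A B := logBanachMazur 𝕜 A.Space B.Space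
  edist_self A := by
    rw [logBanachMazur, EReal.toENNReal_of_nonpos]
    rw [← ENNReal.log_one]
    exact ENNReal.log_monotone (banachMazur_self_le 𝕜 _)
  edist_comm A B := by rw [logBanachMazur, logBanachMazur, banachMazur_comm]
  edist_triangle A B C := logBanachMazur_triangle 𝕜 _ _ _

/-! ### Banach spaces, finite representability, the classes `X^f` -/

/-- A Banach space over `𝕜`. -/
structure BanachSpace (𝕜 : Type u) [RCLike 𝕜] : Type (u + 1) where
  /-- the underlying type -/
  carrier : Type u
  [normedAddCommGroup : NormedAddCommGroup carrier]
  [normedSpace : NormedSpace 𝕜 carrier]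
  [completeSpace : CompleteSpace carrier]

attribute [instance] BanachSpace.normedAddCommGroup BanachSpace.normedSpace
  BanachSpace.completeSpace

instance (𝕜 : Type u) [RCLike 𝕜] : CoeSort (BanachSpace 𝕜) (Type u) := ⟨BanachSpace.carrier⟩

/-- `X` is finitely representable in `Y`. -/
def FinRepresentable (𝕜 : Type u) [RCLike 𝕜] (X : Type v) (Y : Type w)
    [NormedAddCommGroup X] [NormedSpace 𝕜 X] [NormedAddCommGroup Y] [NormedSpace 𝕜 Y] : Prop :=
  ∀ ε : ℝ, 0 < ε → ∀ A : Submodule 𝕜 X, FiniteDimensional 𝕜 A →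
    ∃ (B : Submodule 𝕜 Y) (u : A ≃L[𝕜] B),
      ‖(u : A →L[𝕜] B)‖ * ‖(u.symm : B →L[𝕜] A)‖ ≤ 1 + ε

/-- The class `X^f` of all Banach spaces that are finitely equivalent to `X`. -/
def finClass {𝕜 : Type u} [RCLike 𝕜] (X : BanachSpace 𝕜) : Set (BanachSpace 𝕜) :=
  {Y | FinRepresentable 𝕜 X Y ∧ FinRepresentable 𝕜 Y X}

/-- `H(X)`: the isometry classes of the finite-dimensional subspaces of `X`. -/
def finSubspaces (𝕜 : Type u) [RCLike 𝕜] (X : Type v) [NormedAddCommGroup X] [NormedSpace 𝕜 X] :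
    Set (Minkowski 𝕜) :=
  {A | ∃ B : Submodule 𝕜 X, FiniteDimensional 𝕜 B ∧ Nonempty (A.Space ≃ₗᵢ[𝕜] B)}

/-- `S` is the Minkowski base of the (nonempty) class `K` of finite equivalence: it is the
closure of `H(Y)` in the Minkowski space, for each `Y` in `K`. -/
def IsMinkowskiBase {𝕜 : Type u} [RCLike 𝕜] (S : Set (Minkowski 𝕜)) (K : Set (BanachSpace 𝕜)) :
    Prop :=
  K.Nonempty ∧ ∀ Y ∈ K, S = closure (finSubspaces 𝕜 Y)

/-! ### Ultraproducts of Banach spaces -/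

section ultraproduct

variable (𝕜 : Type u) [RCLike 𝕜] {I : Type u} (E : I → Type u)
  [∀ i, NormedAddCommGroup (E i)] [∀ i, NormedSpace 𝕜 (E i)] (D : Ultrafilter I)

/-- The bounded families `x` with `lim_D ‖x i‖ = 0`. -/
def ultraNull : Submodule 𝕜 (lp E ∞) where
  carrier := {x | Tendsto (fun i => ‖x i‖) D (𝓝 0)}
  zero_mem' := by simp
  add_mem' {x y} hx hy := by
    have h := Tendsto.add hx hy
    rw [add_zero] at h
    exact squeeze_zero (fun i => norm_nonneg _) (fun i => norm_add_le (x i) (y i)) h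
  smul_mem' c x hx := by
    have h := Tendsto.const_mul ‖c‖ hx
    rw [mul_zero] at h
    exact h.congr fun i => (norm_smul c (x i)).symm

instance isClosed_ultraNull : IsClosed (ultraNull 𝕜 E D : Set (lp E ∞)) := by
  refine isClosed_of_closure_subset fun x hx => ?_
  refine Metric.tendsto_nhds.2 fun ε hε => ?_
  obtain ⟨y, hy, hxy⟩ := Metric.mem_closure_iff.1 hx (ε / 2) (half_pos hε)
  filter_upwards [Metric.tendsto_nhds.1 hy (ε / 2) (half_pos hε)] with i hi
  have h1 : ‖(x - y) i‖ ≤ ‖x - y‖ := lp.norm_apply_le_norm ENNReal.top_ne_zero (x - y) i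
  have h2 : ‖x i‖ ≤ ‖(x - y) i‖ + ‖y i‖ := by
    simpa using norm_add_le ((x - y) i) (y i)
  rw [dist_eq_norm] at hxy
  simp only [Real.dist_eq, sub_zero, abs_norm] at hi ⊢
  linarith

/-- The ultraproduct `(E i)_D`. -/
def ultraproduct [∀ i, CompleteSpace (E i)] : BanachSpace 𝕜 where
  carrier := lp E ∞ ⧸ ultraNull 𝕜 E D

end ultraproduct

end

/-! For `A` in `𝔑` consider the set of all `C` in `𝔑` that contain `A` isometrically. By (A₀) these
sets are directed downwards, and they are nonempty, so some ultrafilter `D` contains them all. Let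
`X` be the ultraproduct along `D`. Each `A` embeds isometrically into `D`-almost every factor, hence
into `X`. Conversely, lift a finite-dimensional subspace of `X` linearly to bounded families. The
norm of `X` is the `D`-limit of the coordinate norms, and compactness of the unit sphere makes this
limit uniform, so some coordinate map is almost isometric. The subspace is thus a limit of subspaces
of the factors, which lie in `𝔑` by (H), and (C) puts the limit in `𝔑`. So `H(X) = 𝔑` even before
taking closures, and finite equivalence preserves the closure of `H`. -/

/-! ### Representatives of isometry classes and closure in the Minkowski space -/

namespace Minkowski

variable {𝕜 : Type u} [RCLike 𝕜]

/-- Every finite-dimensional normed space is isometric to a point of the Minkowski space. -/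
theorem exists_linearIsometryEquiv (V : Type v) [NormedAddCommGroup V] [NormedSpace 𝕜 V]
    [FiniteDimensional 𝕜 V] : ∃ A : Minkowski 𝕜, Nonempty (A.Space ≃ₗᵢ[𝕜] V) := by
  let e : V ≃ₗ[𝕜] (Fin (Module.finrank 𝕜 V) → 𝕜) := (Module.finBasis 𝕜 V).equivFun
  let p : FinNorm 𝕜 :=
    { dim := Module.finrank 𝕜 V
      toSeminorm := (normSeminorm 𝕜 V).comp e.symm.toLinearMap
      eq_zero_of_norm_eq_zero := fun x hx => by
        have : ‖e.symm x‖ = 0 := hx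
        simpa using this }
  let f : p.Space ≃ₗᵢ[𝕜] V := { toLinearEquiv := e.symm, norm_map' := fun x => rfl }
  obtain ⟨g⟩ : Nonempty ((Quotient.out (Quotient.mk (FinNorm.isometrySetoid 𝕜) p)).Space
      ≃ₗᵢ[𝕜] p.Space) := Quotient.mk_out (s := FinNorm.isometrySetoid 𝕜) p
  exact ⟨Quotient.mk _ p, ⟨g.trans f⟩⟩

/-- Distortion at most `1 + δ` gives distance at most `log (1 + δ)`, which tends to `0` with `δ`. -/
theorem mem_closure_of_forall_equiv {S : Set (Minkowski 𝕜)} {A : Minkowski 𝕜}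
    (h : ∀ δ : ℝ, 0 < δ → ∃ B ∈ S, ∃ u : A.Space ≃L[𝕜] B.Space,
      ‖(u : A.Space →L[𝕜] B.Space)‖ * ‖(u.symm : B.Space →L[𝕜] A.Space)‖ ≤ 1 + δ) :
    A ∈ closure S := by
  refine EMetric.mem_closure_iff.2 fun ε hε => ?_
  have hcont : Tendsto (fun δ : ℝ => (ENNReal.log (ENNReal.ofReal (1 + δ))).toENNReal)
      (𝓝[>] 0) (𝓝 0) := by
    have : Continuous fun δ : ℝ => (ENNReal.log (ENNReal.ofReal (1 + δ))).toENNReal :=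
      EReal.continuous_toENNReal.comp
        (ENNReal.continuous_log.comp (ENNReal.continuous_ofReal.comp (by fun_prop)))
    simpa using (this.tendsto 0).mono_left nhdsWithin_le_nhds
  obtain ⟨δ, hδε, hδ⟩ := ((hcont.eventually_lt_const hε).and self_mem_nhdsWithin).exists
  obtain ⟨B, hB, u, hu⟩ := h δ hδ
  refine ⟨B, hB, lt_of_le_of_lt (EReal.toENNReal_le_toENNReal (ENNReal.log_monotone ?_)) hδε⟩
  refine (iInf_le _ u).trans ?_
  rw [← ofReal_norm, ← ofReal_norm, ← ENNReal.ofReal_mul (norm_nonneg _)]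
  exact ENNReal.ofReal_le_ofReal hu

/-- Carries distortion bounds from actual subspaces to the chosen representatives of their isometry
classes. -/
theorem norm_mul_norm_symm_trans_isometry {X : Type*} {Y : Type*} {X' : Type*} {Y' : Type*}
    [NormedAddCommGroup X] [NormedSpace 𝕜 X] [NormedAddCommGroup Y] [NormedSpace 𝕜 Y]
    [NormedAddCommGroup X'] [NormedSpace 𝕜 X'] [NormedAddCommGroup Y'] [NormedSpace 𝕜 Y']
    (e : X' ≃ₗᵢ[𝕜] X) (u : X ≃L[𝕜] Y) (f : Y' ≃ₗᵢ[𝕜] Y) :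
    ∃ w : X' ≃L[𝕜] Y', ‖(w : X' →L[𝕜] Y')‖ * ‖(w.symm : Y' →L[𝕜] X')‖ ≤
      ‖(u : X →L[𝕜] Y)‖ * ‖(u.symm : Y →L[𝕜] X)‖ := by
  refine ⟨(e.toContinuousLinearEquiv.trans u).trans f.symm.toContinuousLinearEquiv,
    mul_le_mul ?_ ?_ (norm_nonneg _) (norm_nonneg _)⟩
  · refine ContinuousLinearMap.opNorm_le_bound _ (norm_nonneg _) fun x => ?_
    simpa using (u : X →L[𝕜] Y).le_opNorm (e x)
  · refine ContinuousLinearMap.opNorm_le_bound _ (norm_nonneg _) fun x => ?_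
    simpa using (u.symm : Y →L[𝕜] X).le_opNorm (f x)

end Minkowski

/-! ### Finite representability and closures of `H` -/

section finite_representability

variable {𝕜 : Type u} [RCLike 𝕜]

theorem FinRepresentable.refl (X : Type v) [NormedAddCommGroup X] [NormedSpace 𝕜 X] :
    FinRepresentable 𝕜 X X := fun ε hε A _ => by
  refine ⟨A, ContinuousLinearEquiv.refl 𝕜 A, ?_⟩
  have h : ‖ContinuousLinearMap.id 𝕜 A‖ ≤ 1 := ContinuousLinearMap.norm_id_le
  calc ‖ContinuousLinearMap.id 𝕜 A‖ * ‖ContinuousLinearMap.id 𝕜 A‖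
      ≤ 1 * 1 := mul_le_mul h h (norm_nonneg _) zero_le_one
    _ ≤ 1 + ε := by linarith

theorem FinRepresentable.finSubspaces_subset_closure {X : Type v} {Y : Type w}
    [NormedAddCommGroup X] [NormedSpace 𝕜 X] [NormedAddCommGroup Y] [NormedSpace 𝕜 Y]
    (h : FinRepresentable 𝕜 X Y) : finSubspaces 𝕜 X ⊆ closure (finSubspaces 𝕜 Y) := by
  rintro A ⟨V, hV, ⟨e⟩⟩
  refine Minkowski.mem_closure_of_forall_equiv fun δ hδ => ?_
  obtain ⟨W, u, hu⟩ := h δ hδ V hV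
  have : FiniteDimensional 𝕜 W := u.toLinearEquiv.finiteDimensional
  obtain ⟨B, ⟨f⟩⟩ := Minkowski.exists_linearIsometryEquiv (𝕜 := 𝕜) W
  obtain ⟨w, hw⟩ := Minkowski.norm_mul_norm_symm_trans_isometry e u f
  exact ⟨B, ⟨W, this, ⟨f⟩⟩, w, hw.trans hu⟩

/-- If the finite-dimensional subspaces of `X` form a closed set, this set is the Minkowski base
of the class of `X`. -/
theorem isMinkowskiBase_finSubspaces {X : BanachSpace 𝕜} (hX : IsClosed (finSubspaces 𝕜 X)) :
    IsMinkowskiBase (finSubspaces 𝕜 X) (finClass X) := by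
  refine ⟨⟨X, FinRepresentable.refl X, FinRepresentable.refl X⟩, fun Y hY => ?_⟩
  refine hY.1.finSubspaces_subset_closure.antisymm ?_
  exact closure_minimal (hY.2.finSubspaces_subset_closure.trans hX.closure_eq.le) hX

theorem mem_finSubspaces_of_linearIsometry {X : Type v} [NormedAddCommGroup X] [NormedSpace 𝕜 X]
    {A : Minkowski 𝕜} (f : A.Space →ₗᵢ[𝕜] X) : A ∈ finSubspaces 𝕜 X :=
  ⟨LinearMap.range f.toLinearMap, inferInstance, ⟨f.equivRange⟩⟩

theorem exists_linearIsometry_of_mem_finSubspaces {X : Type v} [NormedAddCommGroup X]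
    [NormedSpace 𝕜 X] {A : Minkowski 𝕜} (h : A ∈ finSubspaces 𝕜 X) :
    Nonempty (A.Space →ₗᵢ[𝕜] X) := by
  obtain ⟨V, _, ⟨e⟩⟩ := h
  exact ⟨V.subtypeₗᵢ.comp e.toLinearIsometry⟩

/-- An almost isometric linear map from a finite-dimensional space is, up to isometry, an
isomorphism onto a subspace with small distortion. -/
theorem exists_finSubspaces_equiv_of_almost_isometry {V : Type v} {E : Type w}
    [NormedAddCommGroup V] [NormedSpace 𝕜 V] [FiniteDimensional 𝕜 V]
    [NormedAddCommGroup E] [NormedSpace 𝕜 E] {A : Minkowski 𝕜} (e : A.Space ≃ₗᵢ[𝕜] V)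
    (T : V →ₗ[𝕜] E) {a b : ℝ} (ha : 0 < a) (hb : 0 ≤ b)
    (hlow : ∀ x, a * ‖x‖ ≤ ‖T x‖) (hup : ∀ x, ‖T x‖ ≤ b * ‖x‖) :
    ∃ B ∈ finSubspaces 𝕜 E, ∃ u : A.Space ≃L[𝕜] B.Space,
      ‖(u : A.Space →L[𝕜] B.Space)‖ * ‖(u.symm : B.Space →L[𝕜] A.Space)‖ ≤ b * a⁻¹ := by
  have hinj : Function.Injective T := by
    refine (injective_iff_map_eq_zero T).2 fun x hx => ?_
    have h := hlow x
    rw [hx, norm_zero] at h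
    exact norm_le_zero_iff.1 (nonpos_of_mul_nonpos_right h ha)
  let l : V ≃ₗ[𝕜] LinearMap.range T := LinearEquiv.ofInjective T hinj
  let u : V ≃L[𝕜] LinearMap.range T := l.toContinuousLinearEquiv
  have hu : ‖(u : V →L[𝕜] LinearMap.range T)‖ ≤ b :=
    ContinuousLinearMap.opNorm_le_bound _ hb hup
  have hu' : ‖(u.symm : LinearMap.range T →L[𝕜] V)‖ ≤ a⁻¹ := by
    refine ContinuousLinearMap.opNorm_le_bound _ (inv_nonneg.2 ha.le) fun y => ?_
    obtain ⟨x, rfl⟩ := u.surjective y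
    have h : a * ‖x‖ ≤ ‖u x‖ := hlow x
    simpa [le_inv_mul_iff₀ ha] using h
  obtain ⟨B, ⟨f⟩⟩ := Minkowski.exists_linearIsometryEquiv (𝕜 := 𝕜) (LinearMap.range T)
  obtain ⟨w, hw⟩ := Minkowski.norm_mul_norm_symm_trans_isometry e u f
  exact ⟨B, ⟨_, inferInstance, ⟨f⟩⟩, w,
    hw.trans (mul_le_mul hu hu' (norm_nonneg _) hb)⟩

end finite_representability

/-! ### Norms, embeddings and subspaces of ultraproducts -/

section ultraproduct

variable {𝕜 : Type u} [RCLike 𝕜] {I : Type u} {E : I → Type u}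
  [∀ i, NormedAddCommGroup (E i)] [∀ i, NormedSpace 𝕜 (E i)] (D : Ultrafilter I)

/-- The norm in an ultraproduct is the limit of the norms of the components. -/
theorem tendsto_norm_ultraproduct_mk (x : lp E ∞) :
    Tendsto (fun i => ‖x i‖) D (𝓝 ‖(ultraNull 𝕜 E D).mkQ x‖) := by
  obtain ⟨L, -, hL⟩ : ∃ L ∈ Set.Icc 0 ‖x‖, Tendsto (fun i => ‖x i‖) D (𝓝 L) :=
    isCompact_Icc.ultrafilter_le_nhds (D.map fun i => ‖x i‖) (le_principal_iff.2
      (Filter.mem_map.2 (Filter.univ_mem' fun i =>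
        ⟨norm_nonneg _, lp.norm_apply_le_norm ENNReal.top_ne_zero x i⟩)))
  suffices h : ‖(ultraNull 𝕜 E D).mkQ x‖ = L by rwa [h]
  apply le_antisymm
  · refine le_of_forall_pos_le_add fun ε hε => ?_
    classical
    have hS : ∀ᶠ i in (D : Filter I), ‖x i‖ < L + ε :=
      hL.eventually_lt_const (lt_add_of_pos_right L hε)
    have hL0 : 0 ≤ L := ge_of_tendsto' hL fun i => norm_nonneg _
    have hbound : ∀ i, ‖if ‖x i‖ < L + ε then x i else 0‖ ≤ L + ε := fun i => by
      split_ifs with h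
      · exact h.le
      · rw [norm_zero]; positivity
    -- Cutting off the entries of norm at least `L + ε` changes `x` only off a set of `D`, hence by
    -- a null family, and brings the supremum norm down to `L + ε`.
    let y : lp E ∞ := ⟨fun i => if ‖x i‖ < L + ε then x i else 0,
      memℓp_infty ⟨L + ε, by rintro _ ⟨i, rfl⟩; exact hbound i⟩⟩
    have hy : (ultraNull 𝕜 E D).mkQ x = (ultraNull 𝕜 E D).mkQ y := by
      refine (Submodule.Quotient.eq _).2 ?_
      refine tendsto_const_nhds.congr' (hS.mono fun i hi => ?_)
      change 0 = ‖x i - if ‖x i‖ < L + ε then x i else 0‖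
      rw [if_pos hi, sub_self, norm_zero]
    rw [hy]
    exact (Submodule.Quotient.norm_mk_le _ y).trans
      (lp.norm_le_of_forall_le (by positivity) hbound)
  · refine le_of_forall_pos_le_add fun ε hε => ?_
    obtain ⟨y, hy, hyε⟩ := Submodule.Quotient.norm_mk_lt ((ultraNull 𝕜 E D).mkQ x) hε
    have hxy : Tendsto (fun i => ‖(x - y) i‖) D (𝓝 0) :=
      (Submodule.Quotient.eq (ultraNull 𝕜 E D)).1 hy.symm
    refine le_trans ?_ hyε.le
    have := hL.sub hxy
    rw [sub_zero] at this
    refine le_of_tendsto' this fun i => ?_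
    have h1 := lp.norm_apply_le_norm ENNReal.top_ne_zero y i
    have h2 : ‖x i‖ ≤ ‖(x - y) i‖ + ‖y i‖ := by simpa using norm_add_le ((x - y) i) (y i)
    linarith

/-- Pointwise convergence of the norms `‖T i x‖` to `‖x‖` on a finite-dimensional space, for
uniformly bounded linear maps `T i`, is uniform on bounded sets. -/
theorem eventually_almost_isometry {V : Type*} [NormedAddCommGroup V] [NormedSpace 𝕜 V]
    [FiniteDimensional 𝕜 V] {l : Filter I} (T : ∀ i, V →ₗ[𝕜] E i) {M : ℝ}
    (hM : ∀ i x, ‖T i x‖ ≤ M * ‖x‖) (hT : ∀ x, Tendsto (fun i => ‖T i x‖) l (𝓝 ‖x‖))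
    {ε : ℝ} (hε : 0 < ε) :
    ∀ᶠ i in l, ∀ x, (1 - ε) * ‖x‖ ≤ ‖T i x‖ ∧ ‖T i x‖ ≤ (1 + ε) * ‖x‖ := by
  have : ProperSpace V := FiniteDimensional.proper 𝕜 V
  -- Moving to a point of an `r`-net costs `|M| * r` in `‖T i x‖` and `r` in `‖x‖`; the other `ε /
  -- 2` is the error at the net point.
  obtain ⟨r, hr, hrε⟩ : ∃ r : ℝ, 0 < r ∧ (|M| + 1) * r ≤ ε / 2 :=
    ⟨ε / 2 / (|M| + 1), by positivity, by field_simp; rfl⟩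
  obtain ⟨t, -, htfin, ht⟩ := (isCompact_sphere (0 : V) 1).finite_cover_balls hr
  have hev : ∀ᶠ i in l, ∀ y ∈ t, |‖T i y‖ - ‖y‖| < ε / 2 :=
    (Filter.eventually_all_finite htfin).2 fun y _ => by
      simpa [Real.dist_eq] using Metric.tendsto_nhds.1 (hT y) (ε / 2) (half_pos hε)
  refine hev.mono fun i hi => ?_
  have hsphere : ∀ x : V, ‖x‖ = 1 → |‖T i x‖ - ‖x‖| ≤ ε := fun x hx => by
    obtain ⟨y, hy, hxy⟩ := Set.mem_iUnion₂.1 (ht (mem_sphere_zero_iff_norm.2 hx))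
    rw [Metric.mem_ball, dist_eq_norm] at hxy
    have h1 : |‖T i x‖ - ‖T i y‖| ≤ |M| * r := by
      refine (abs_norm_sub_norm_le _ _).trans ?_
      rw [← map_sub]
      exact (hM i _).trans (mul_le_mul (le_abs_self M) hxy.le (norm_nonneg _) (abs_nonneg M))
    have h2 : |‖x‖ - ‖y‖| ≤ r := (abs_norm_sub_norm_le _ _).trans hxy.le
    have h3 := hi y hy
    rw [abs_lt] at h3
    rw [abs_le] at h1 h2 ⊢
    constructor <;> linarith
  intro x
  rcases eq_or_ne x 0 with rfl | hx
  · simp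
  have hx' : 0 < ‖x‖ := norm_pos_iff.2 hx
  have h := hsphere (((‖x‖⁻¹ : ℝ) : 𝕜) • x) (by
    rw [norm_smul, RCLike.norm_ofReal, abs_of_pos (inv_pos.2 hx'), inv_mul_cancel₀ hx'.ne'])
  rw [map_smul, norm_smul, norm_smul, RCLike.norm_ofReal, abs_of_pos (inv_pos.2 hx'),
    inv_mul_cancel₀ hx'.ne', abs_le] at h
  have h4 : ‖x‖ * (‖x‖⁻¹ * ‖T i x‖) = ‖T i x‖ := mul_inv_cancel_left₀ hx'.ne' _
  constructor <;> nlinarith [h.1, h.2]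

variable [∀ i, CompleteSpace (E i)]

/-- A space that embeds isometrically into `D`-almost all `E i` embeds isometrically into the
ultraproduct. -/
theorem exists_linearIsometry_ultraproduct {V : Type*} [NormedAddCommGroup V] [NormedSpace 𝕜 V]
    (h : ∀ᶠ i in (D : Filter I), Nonempty (V →ₗᵢ[𝕜] E i)) :
    Nonempty (V →ₗᵢ[𝕜] ultraproduct 𝕜 E D) := by
  classical
  -- The value `0` where no embedding exists keeps the family bounded; it is invisible to `D`.
  let j : ∀ i, V →ₗ[𝕜] E i := fun i =>
    if h : Nonempty (V →ₗᵢ[𝕜] E i) then h.some.toLinearMap else 0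
  have hj : ∀ i v, ‖j i v‖ ≤ ‖v‖ := fun i v => by
    by_cases h : Nonempty (V →ₗᵢ[𝕜] E i) <;> simp [j, h]
  let T : V →ₗ[𝕜] lp E ∞ :=
    { toFun := fun v => ⟨fun i => j i v,
        memℓp_infty ⟨‖v‖, by rintro _ ⟨i, rfl⟩; exact hj i v⟩⟩
      map_add' := fun v w => by ext i; exact map_add (j i) v w
      map_smul' := fun c v => by ext i; exact map_smul (j i) c v }
  refine ⟨⟨(ultraNull 𝕜 E D).mkQ ∘ₗ T, fun v => ?_⟩⟩
  refine tendsto_nhds_unique (tendsto_norm_ultraproduct_mk D (T v)) ?_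
  refine tendsto_const_nhds.congr' (h.mono fun i hi => ?_)
  simp [T, j, hi]

/-- Finite-dimensional subspaces of an ultraproduct are limits of subspaces of the factors. -/
theorem finSubspaces_ultraproduct_subset_closure :
    finSubspaces 𝕜 (ultraproduct 𝕜 E D) ⊆ closure (⋃ i, finSubspaces 𝕜 (E i)) := by
  rintro A ⟨V, hV, ⟨e⟩⟩
  -- The section `s` is merely linear; its restriction to the finite-dimensional `V` is
  -- automatically bounded, which gives a bound uniform in `i`.
  obtain ⟨s, hs⟩ := (ultraNull 𝕜 E D).mkQ.exists_rightInverse_of_surjective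
    (LinearMap.range_eq_top.2 (Submodule.mkQ_surjective _))
  let T : V →ₗ[𝕜] lp E ∞ := s ∘ₗ V.subtype
  have hmk : ∀ v : V, (ultraNull 𝕜 E D).mkQ (T v) = v.1 := fun v =>
    LinearMap.congr_fun hs v.1
  let Ti : ∀ i, V →ₗ[𝕜] E i := fun i =>
    { toFun := fun v => T v i
      map_add' := fun v w => by simp
      map_smul' := fun c v => by simp }
  have hM : ∀ i v, ‖Ti i v‖ ≤ ‖LinearMap.toContinuousLinearMap T‖ * ‖v‖ := fun i v =>
    (lp.norm_apply_le_norm ENNReal.top_ne_zero (T v) i).trans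
      ((LinearMap.toContinuousLinearMap T).le_opNorm v)
  have hT : ∀ v, Tendsto (fun i => ‖Ti i v‖) D (𝓝 ‖v‖) := fun v => by
    have h := tendsto_norm_ultraproduct_mk (𝕜 := 𝕜) D (T v)
    rwa [hmk] at h
  refine Minkowski.mem_closure_of_forall_equiv fun δ hδ => ?_
  obtain ⟨ε, hε, hε1, hεδ⟩ : ∃ ε : ℝ, 0 < ε ∧ ε < 1 ∧ (1 + ε) * (1 - ε)⁻¹ ≤ 1 + δ := by
    -- This `ε` solves `(1 + ε) / (1 - ε) = 1 + δ`.
    refine ⟨δ / (2 + δ), by positivity, by rw [div_lt_one] <;> linarith, le_of_eq ?_⟩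
    have : 1 - δ / (2 + δ) = 2 / (2 + δ) := by field_simp; ring
    rw [this]; field_simp; ring
  obtain ⟨i, hi⟩ := (eventually_almost_isometry Ti hM hT hε).exists
  obtain ⟨B, hB, u, hu⟩ := exists_finSubspaces_equiv_of_almost_isometry e (Ti i)
    (sub_pos.2 hε1) (by positivity) (fun x => (hi x).1) (fun x => (hi x).2)
  exact ⟨B, Set.mem_iUnion.2 ⟨i, hB⟩, u, hu.trans hεδ⟩

end ultraproduct

/-! ### The ultrafilter on `𝔑` and the main theorem -/

/-- If any two members of `𝔑` are subspaces of a third one, some ultrafilter on `𝔑` contains, for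
each `A`, the set of all members that contain `A` isometrically. -/
theorem exists_ultrafilter_eventually_mem_finSubspaces {𝕜 : Type u} [RCLike 𝕜]
    (𝔑 : Set (Minkowski 𝕜)) (hne : 𝔑.Nonempty)
    (hA₀ : ∀ A ∈ 𝔑, ∀ B ∈ 𝔑, ∃ C ∈ 𝔑,
      A ∈ finSubspaces 𝕜 C.Space ∧ B ∈ finSubspaces 𝕜 C.Space) :
    ∃ D : Ultrafilter 𝔑, ∀ A ∈ 𝔑,
      ∀ᶠ C : 𝔑 in (D : Filter 𝔑), A ∈ finSubspaces 𝕜 (C : Minkowski 𝕜).Space := by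
  let S : 𝔑 → Set 𝔑 := fun A =>
    {C | (A : Minkowski 𝕜) ∈ finSubspaces 𝕜 (C : Minkowski 𝕜).Space}
  -- Isometric embeddings compose, so (A₀) puts some `S C` inside `S A ∩ S B`.
  have hmono : ∀ A C : 𝔑, C ∈ S A → S C ⊆ S A := fun A C hAC F hCF => by
    obtain ⟨f⟩ := exists_linearIsometry_of_mem_finSubspaces hAC
    obtain ⟨g⟩ := exists_linearIsometry_of_mem_finSubspaces hCF
    exact mem_finSubspaces_of_linearIsometry (g.comp f)
  have : Nonempty 𝔑 := hne.to_subtype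
  have hdir : Directed (· ≥ ·) fun A : 𝔑 => 𝓟 (S A) := fun A B => by
    obtain ⟨C, hC, hAC, hBC⟩ := hA₀ A A.2 B B.2
    exact ⟨⟨C, hC⟩, principal_mono.2 (hmono A ⟨C, hC⟩ hAC), principal_mono.2 (hmono B ⟨C, hC⟩ hBC)⟩
  have : NeBot (⨅ A : 𝔑, 𝓟 (S A)) := iInf_neBot_of_directed hdir fun A =>
    principal_neBot_iff.2 ⟨A, mem_finSubspaces_of_linearIsometry LinearIsometry.id⟩
  refine ⟨Ultrafilter.of (⨅ A : 𝔑, 𝓟 (S A)), fun A hA => ?_⟩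
  exact Ultrafilter.of_le _ (mem_iInf_of_mem ⟨A, hA⟩ (mem_principal_self _))

theorem theorem1 {𝕜 : Type u} [RCLike 𝕜] (𝔑 : Set (Minkowski 𝕜)) (hne : 𝔑.Nonempty)
    (hC : IsClosed 𝔑)
    (hH : ∀ A ∈ 𝔑, ∀ B ∈ finSubspaces 𝕜 A.Space, B ∈ 𝔑)
    (hA₀ : ∀ A ∈ 𝔑, ∀ B ∈ 𝔑, ∃ C ∈ 𝔑,
      A ∈ finSubspaces 𝕜 C.Space ∧ B ∈ finSubspaces 𝕜 C.Space) :
    ∃ X : BanachSpace 𝕜, IsMinkowskiBase 𝔑 (finClass X) ∧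
      ∃ D : Ultrafilter 𝔑,
        Nonempty (X ≃ₗᵢ[𝕜] ultraproduct 𝕜 (fun A : 𝔑 => (A : Minkowski 𝕜).Space) D) := by
  obtain ⟨D, hD⟩ := exists_ultrafilter_eventually_mem_finSubspaces 𝔑 hne hA₀
  let X := ultraproduct 𝕜 (fun A : 𝔑 => (A : Minkowski 𝕜).Space) D
  have hX : 𝔑 = finSubspaces 𝕜 X := by
    apply Set.Subset.antisymm
    · intro A hA
      obtain ⟨f⟩ := exists_linearIsometry_ultraproduct (𝕜 := 𝕜) D (V := A.Space)
        ((hD A hA).mono fun C hC => exists_linearIsometry_of_mem_finSubspaces hC)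
      exact mem_finSubspaces_of_linearIsometry f
    · refine (finSubspaces_ultraproduct_subset_closure D).trans (closure_minimal ?_ hC)
      exact Set.iUnion_subset fun A => hH A A.2
  have hbase := isMinkowskiBase_finSubspaces (hX ▸ hC)
  rw [← hX] at hbase
  exact ⟨X, hbase, D, ⟨LinearIsometryEquiv.refl 𝕜 X⟩⟩
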